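/- Let $m,d\in\mathbb N$, $H\in(\tfrac12,1)$, and let constants $M>0$, $L>0$, $\lambda\in(1-H,1]$, $\gamma\in(\tfrac1H-1,1]$, $M_N>0$ (one for each $N>0$) and $K\ge 0$ be given. Let $\alpha\in\bigl(1-H,\min\{\tfrac12,\lambda,\tfrac{\gamma}{1+\gamma}\}\bigr)$, $0<\delta<\alpha-(1-H)$ and $\kappa=\frac1{1-\alpha}$. Then there are positive constants $C_1,C_2,C_3$, depending only on $m,d,H,\alpha,\delta$ and the constants $M,L,\lambda,\gamma,(M_N)_{N>0},K$, such that the following holds. Let $b:[0,1]\times\mathbb R^m\to\mathbb R^m$ satisfy $$|b(t,x)-b(t,y)|\le L|x-y|,\qquad |b(t,x)|\le L(1+|x|)$$ for all $t\in[0,1]$, $x,y\in\mathbb R^m$. Let $\sigma:[0,1]\times\mathbb R^m\to\mathbb R^{m\times d}$ be differentiable in the space variable with $|\sigma(0,0)|\le K$ and, for all $s,t\in[0,1]$, $x,y\in\mathbb R^m$ and $i=1,\dots,m$, $$|\sigma(t,x)-\sigma(t,y)|\le M|x-y|,$$ $$|\partial_{x_i}\sigma(t,x)-\partial_{x_i}\sigma(t,y)|\le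 M_N|x-y|^\gamma\quad\text{if } |x|\vee|y|\le N,\ N>0,$$ $$|\sigma(t,x)-\sigma(s,x)|+|\partial_{x_i}\sigma(t,x)-\partial_{x_i}\sigma(s,x)|\le M|t-s|^\lambda .$$ Here $|\cdot|$ is the Euclidean norm on vectors and the Frobenius norm on matrices. Let $g:[0,1]\to\mathbb R^d$ be Hölder continuous of order $H-\varepsilon$ for every $0<\varepsilon<H$, let $x_0\in\mathbb R^m$, and let $x$ be a solution of $$x_t=x_0+\int_0^t b(s,x_s)\,ds+\int_0^t\sigma(s,x_s)\,dg_s,\qquad t\in[0,1],$$ where the last integral is a Riemann–Stieltjes integral and $x\in W_0^{\alpha,\infty}([0,1]:\mathbb R^m)$, that is, $x$ is measurable and $$\sup_{0\le t\le1}\Bigl\{|x_t|+\int_0^t\frac{|x_t-x_s|}{(t-s)^{\alpha+1}}\,ds\Bigr\}<\infty .$$ Then $x$ is $(1-\alpha)$-Hölder continuous on $[0,1]$ and $$\|x\|_\infty\le C_1(1+|x_0|)\exp\{C_2\|g\|_{1-\alpha+\delta}^\kappa\},$$ $$\|x\|_{1-\alpha}\le C_3(1+|x_0|)\bigl(1+\|g\|_{1-\alpha+\delta}^\kappa\bigr)\bigl(1+\|g\|_{1-\alpha+\delta}\bigr)\bigl(1+\exp\{C_2\|g\|_{1-\alpha+\delta}^\kappa\}\bigr),$$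 where $\|f\|_\infty=\sup_{0\le t\le1}|f_t|$ and $\|f\|_\beta=\sup_{0\le s<t\le1}\frac{|f_t-f_s|}{|t-s|^\beta}$. -/

import Mathlib

open Set MeasureTheory

-- Matrices carry the Frobenius norm `|A|² = ∑ i j, |A i j|²`.
attribute [local instance] Matrix.frobeniusNormedAddCommGroup Matrix.frobeniusNormedSpace

noncomputable section

namespace YoungEq

/-- Membership in `C^β([0,1] : E)`; only the values of `f` on `[0,1]` matter. -/
def IsHolder {E : Type*} [NormedAddCommGroup E] (β : ℝ) (f : ℝ → E) : Prop :=
  ∃ C : ℝ, ∀ s ∈ Icc (0 : ℝ) 1, ∀ t ∈ Icc (0 : ℝ) 1, ‖f t - f s‖ ≤ C * |t - s| ^ β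

/-- The Hölder seminorm `‖f‖_β = sup_{0 ≤ s < t ≤ 1} |f t - f s| / |t - s|^β`
(meaningful for `f` with `IsHolder β f`). -/
def holderNorm {E : Type*} [NormedAddCommGroup E] (β : ℝ) (f : ℝ → E) : ℝ :=
  sSup {y : ℝ | ∃ s t : ℝ, 0 ≤ s ∧ s < t ∧ t ≤ 1 ∧ y = ‖f t - f s‖ / |t - s| ^ β}

/-- The supremum norm `‖f‖_∞ = sup_{0 ≤ t ≤ 1} |f t|` (meaningful for bounded `f`). -/
def supNorm {E : Type*} [NormedAddCommGroup E] (f : ℝ → E) : ℝ :=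
  sSup ((fun t => ‖f t‖) '' Icc (0 : ℝ) 1)

/-- Membership in `W_0^{α,∞}([0,1] : E)`: `f` is Lebesgue measurable on `[0,1]` and
`sup_{0 ≤ t ≤ 1} { |f t| + ∫_0^t |f t - f s| / (t - s)^(α+1) ds } < ∞`. -/
def MemW0 {E : Type*} [NormedAddCommGroup E] [MeasurableSpace E] (α : ℝ) (f : ℝ → E) : Prop :=
  AEMeasurable f (volume.restrict (Icc (0 : ℝ) 1)) ∧
    (⨆ t ∈ Icc (0 : ℝ) 1, (ENNReal.ofReal ‖f t‖ +
      ∫⁻ s in Ioo 0 t, ENNReal.ofReal (‖f t - f s‖ / (t - s) ^ (α + 1)))) < ⊤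

/-- The Riemann–Stieltjes integral `∫_a^b F dg` exists and equals `I`: the sums
`∑ F(ξ_i) (g(u_{i+1}) - g(u_i))` over tagged partitions `a = u_0 ≤ ξ_0 ≤ u_1 ≤ ⋯ ≤ u_n = b`
converge to `I` as the mesh tends to `0`. -/
def HasRSIntegral {m d : ℕ} (F : ℝ → Matrix (Fin m) (Fin d) ℝ)
    (g : ℝ → EuclideanSpace ℝ (Fin d)) (a b : ℝ) (I : EuclideanSpace ℝ (Fin m)) : Prop :=
  ∀ ε > 0, ∃ η > 0, ∀ (n : ℕ) (u ξ : ℕ → ℝ), u 0 = a → u n = b →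
    (∀ i < n, u i ≤ ξ i ∧ ξ i ≤ u (i + 1) ∧ u (i + 1) - u i < η) →
    ‖∑ i ∈ Finset.range n, Matrix.toEuclideanLin (F (ξ i)) (g (u (i + 1)) - g (u i)) - I‖ < ε

/-- `x` solves `x_t = x₀ + ∫_0^t b(s, x_s) ds + ∫_0^t σ(s, x_s) dg_s` for all `t ∈ [0,1]`, where
both integrals exist (the first one as a Lebesgue integral, the second one as a
Riemann–Stieltjes integral). -/
def IsSolution {m d : ℕ}
    (b : ℝ → EuclideanSpace ℝ (Fin m) → EuclideanSpace ℝ (Fin m))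
    (σ : ℝ → EuclideanSpace ℝ (Fin m) → Matrix (Fin m) (Fin d) ℝ)
    (g : ℝ → EuclideanSpace ℝ (Fin d)) (x₀ : EuclideanSpace ℝ (Fin m))
    (x : ℝ → EuclideanSpace ℝ (Fin m)) : Prop :=
  IntervalIntegrable (fun s => b s (x s)) volume 0 1 ∧
    ∀ t ∈ Icc (0 : ℝ) 1, ∃ I : EuclideanSpace ℝ (Fin m),
      HasRSIntegral (fun s => σ s (x s)) g 0 t I ∧ x t = x₀ + (∫ s in (0 : ℝ)..t, b s (x s)) + I

/-- The partial derivative `∂_{x_i} σ(t, x)`. -/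
def partialDeriv {m d : ℕ} (σ : ℝ → EuclideanSpace ℝ (Fin m) → Matrix (Fin m) (Fin d) ℝ)
    (i : Fin m) (t : ℝ) (x : EuclideanSpace ℝ (Fin m)) : Matrix (Fin m) (Fin d) ℝ :=
  fderiv ℝ (σ t) x (EuclideanSpace.single i 1)

/-- The regularity conditions on the diffusion coefficient `σ`, with constants
`M`, `lam`, `gam` and `MN N` (`N > 0`). -/
structure SigmaAssumption {m d : ℕ} (M lam gam : ℝ) (MN : ℝ → ℝ)
    (σ : ℝ → EuclideanSpace ℝ (Fin m) → Matrix (Fin m) (Fin d) ℝ) : Prop where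
  differentiable : ∀ t ∈ Icc (0 : ℝ) 1, Differentiable ℝ (σ t)
  lipschitz : ∀ t ∈ Icc (0 : ℝ) 1, ∀ x y, ‖σ t x - σ t y‖ ≤ M * ‖x - y‖
  deriv_holder : ∀ N > 0, ∀ t ∈ Icc (0 : ℝ) 1, ∀ x y, ‖x‖ ≤ N → ‖y‖ ≤ N → ∀ i,
    ‖partialDeriv σ i t x - partialDeriv σ i t y‖ ≤ MN N * ‖x - y‖ ^ gam
  time_holder : ∀ x, ∀ t ∈ Icc (0 : ℝ) 1, ∀ s ∈ Icc (0 : ℝ) 1, ∀ i,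
    ‖σ t x - σ s x‖ + ‖partialDeriv σ i t x - partialDeriv σ i s x‖ ≤ M * |t - s| ^ lam

/-- The Lipschitz and linear growth conditions on the drift coefficient `b`. -/
structure DriftAssumption {m : ℕ} (L : ℝ)
    (b : ℝ → EuclideanSpace ℝ (Fin m) → EuclideanSpace ℝ (Fin m)) : Prop where
  lipschitz : ∀ t ∈ Icc (0 : ℝ) 1, ∀ x y, ‖b t x - b t y‖ ≤ L * ‖x - y‖
  growth : ∀ t ∈ Icc (0 : ℝ) 1, ∀ x, ‖b t x‖ ≤ L * (1 + ‖x‖)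

end YoungEq

end

/-!
The hypotheses give `α + (1 - α + δ) = 1 + δ > 1`, so an `α`-Hölder integrand and a
`(1 - α + δ)`-Hölder driving path are in Young's range, and no fractional calculus is needed.

A Riemann–Stieltjes integral that exists is the limit of its dyadic sums with tags at the right end
points. One refinement changes such a sum by a geometrically small amount, which yields Young's
estimate `HasRSIntegral.norm_sub_le` with the integrand evaluated at the right end point. As the
tags avoid the left end point, Hölder continuity of the integrand is needed only away from it. This
matters because the integral in the definition of `W_0^{α,∞}` is empty at time `0`: an averaging
argument shows that `x` is `α`-Hölder continuous on `(0, 1]` (`MemW0.exists_holder`), and nothing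
more can be said at `0` before the equation is used.

For a solution, Young's estimate and the growth of the coefficients give
`|x_t - x_s| ≤ Q (1 + A) (t - s) ^ (1 - α) + Q N (t - s)`, where `A` bounds `|x|` on `[s, t]`, `N` is
an `α`-Hölder constant on `(s, t]`, and `Q` is a constant times `1 + ‖g‖_{1-α+δ}`
(`IsSolution.incrementEstimate`). It is used twice. First, with the qualitative bounds from
`W_0^{α,∞}`, it shows that `x` is `(1 - α)`-Hölder continuous. Second, on an interval of length at
most `Δ`, where `Q Δ ^ (1 - α) = 1 / 4`, one has `N ≤ ‖x‖_{1-α} Δ ^ (1 - 2 α)`, and the last term is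
absorbed (`IncrementEstimate.local_holder`). Hence `1 + |x|` at most doubles over a time `Δ`, and
`1 / Δ = (4 Q) ^ (1 / (1 - α))` such steps produce the exponential in the bound of the supremum
norm. The local Hölder bound, together with the trivial bound for increments over times longer than
`Δ`, gives the bound of the Hölder seminorm.
-/

namespace YoungEq

open Filter Topology

/-! ### Riemann–Stieltjes integrals and the Young estimate -/

theorem norm_toEuclideanLin_le {m d : ℕ} (A : Matrix (Fin m) (Fin d) ℝ)
    (v : EuclideanSpace ℝ (Fin d)) : ‖Matrix.toEuclideanLin A v‖ ≤ ‖A‖ * ‖v‖ := by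
  have h := Matrix.frobenius_norm_mul A (Matrix.replicateCol Unit v.ofLp)
  rw [← Matrix.replicateCol_mulVec, Matrix.frobenius_norm_replicateCol,
    Matrix.frobenius_norm_replicateCol] at h
  rwa [Matrix.toLpLin_apply]

theorem _root_.Finset.sum_range_two_mul {E : Type*} [AddCommMonoid E] (f : ℕ → E) (k : ℕ) :
    ∑ i ∈ Finset.range (2 * k), f i = ∑ i ∈ Finset.range k, (f (2 * i) + f (2 * i + 1)) := by
  induction k with
  | zero => simp
  | succ k ih => rw [mul_add_one, Finset.sum_range_succ, Finset.sum_range_succ,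
      Finset.sum_range_succ _ k, ih, add_assoc]

/-- Additivity of the Riemann–Stieltjes integral: a fixed fine partition of `[a, b]` extends
every partition of `[b, c]` to one of `[a, c]`. -/
theorem HasRSIntegral.sub {m d : ℕ} {F : ℝ → Matrix (Fin m) (Fin d) ℝ}
    {g : ℝ → EuclideanSpace ℝ (Fin d)} {a b c : ℝ} {I J : EuclideanSpace ℝ (Fin m)}
    (hab : a ≤ b) (hI : HasRSIntegral F g a c I) (hJ : HasRSIntegral F g a b J) :
    HasRSIntegral F g b c (I - J) := by
  intro ε hε
  obtain ⟨η₁, hη₁, h₁⟩ := hI (ε / 2) (half_pos hε)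
  obtain ⟨η₂, hη₂, h₂⟩ := hJ (ε / 2) (half_pos hε)
  refine ⟨η₁, hη₁, fun n u ξ hu0 hun hu => ?_⟩
  obtain ⟨k, hk⟩ := exists_nat_gt ((b - a) / min η₁ η₂)
  have hη : 0 < min η₁ η₂ := lt_min hη₁ hη₂
  have hk0 : (0 : ℝ) < k := lt_of_le_of_lt (div_nonneg (by linarith) hη.le) hk
  have hmesh : (b - a) / k < min η₁ η₂ := by
    rw [div_lt_iff₀ hη] at hk
    rw [div_lt_iff₀ hk0]; linarith
  set v : ℕ → ℝ := fun i => a + i * ((b - a) / k) with hv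
  have hv0 : v 0 = a := by simp [hv]
  have hvk : v k = b := by simp only [hv]; field_simp; ring
  have hvs : ∀ i, v (i + 1) - v i = (b - a) / k := fun i => by simp only [hv]; push_cast; ring
  have hvm : ∀ i, v i ≤ v (i + 1) := fun i => by
    have := hvs i
    have : 0 ≤ (b - a) / k := div_nonneg (by linarith) hk0.le
    linarith
  have hJ' := h₂ k v (fun i => v (i + 1)) hv0 hvk
    (fun i _ => ⟨hvm i, le_rfl, by rw [hvs]; exact hmesh.trans_le (min_le_right _ _)⟩)
  -- the concatenated partition and its tags
  set U : ℕ → ℝ := fun i => if i < k then v i else u (i - k) with hU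
  set Ξ : ℕ → ℝ := fun i => if i < k then v (i + 1) else ξ (i - k) with hΞ
  have hU1 : ∀ i ≤ k, U i = v i := by
    intro i hi
    rcases hi.lt_or_eq with h | h
    · simp [hU, h]
    · simp [hU, h, hu0, hvk]
  have hU2 : ∀ j, U (k + j) = u j := fun j => by simp [hU]
  have hΞ1 : ∀ i < k, Ξ i = v (i + 1) := fun i hi => by simp [hΞ, hi]
  have hΞ2 : ∀ j, Ξ (k + j) = ξ j := fun j => by simp [hΞ]
  have hI' := h₁ (k + n) U Ξ (by rw [hU1 0 (Nat.zero_le _), hv0]) (by rw [hU2, hun]) (by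
    intro i hi
    rcases lt_or_ge i k with h | h
    · rw [hU1 i h.le, hU1 (i + 1) h, hΞ1 i h]
      exact ⟨hvm i, le_rfl, by rw [hvs]; exact hmesh.trans_le (min_le_left _ _)⟩
    · obtain ⟨j, rfl⟩ := Nat.exists_eq_add_of_le h
      rw [add_assoc, hU2, hU2, hΞ2]
      exact hu j (by omega))
  rw [Finset.sum_range_add] at hI'
  have e1 : ∑ i ∈ Finset.range k, Matrix.toEuclideanLin (F (Ξ i)) (g (U (i + 1)) - g (U i))
      = ∑ i ∈ Finset.range k, Matrix.toEuclideanLin (F (v (i + 1))) (g (v (i + 1)) - g (v i)) := by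
    refine Finset.sum_congr rfl fun i hi => ?_
    have hi := Finset.mem_range.1 hi
    rw [hΞ1 i hi, hU1 i hi.le, hU1 (i + 1) hi]
  have e2 : ∑ i ∈ Finset.range n,
        Matrix.toEuclideanLin (F (Ξ (k + i))) (g (U (k + i + 1)) - g (U (k + i)))
      = ∑ i ∈ Finset.range n, Matrix.toEuclideanLin (F (ξ i)) (g (u (i + 1)) - g (u i)) := by
    refine Finset.sum_congr rfl fun i _ => ?_
    rw [hΞ2, hU2, add_assoc, hU2]
  rw [e1, e2] at hI'
  set S := ∑ i ∈ Finset.range k, Matrix.toEuclideanLin (F (v (i + 1))) (g (v (i + 1)) - g (v i))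
  set T := ∑ i ∈ Finset.range n, Matrix.toEuclideanLin (F (ξ i)) (g (u (i + 1)) - g (u i))
  calc ‖T - (I - J)‖ = ‖(S + T - I) - (S - J)‖ := by congr 1; abel
    _ ≤ ‖S + T - I‖ + ‖S - J‖ := norm_sub_le _ _
    _ < ε := by linarith

/-- The `n`-th dyadic Riemann–Stieltjes sum on `[s, t]`, with the tags at the right end points. -/
noncomputable def dyadicSum {m d : ℕ} (F : ℝ → Matrix (Fin m) (Fin d) ℝ) (g : ℝ → EuclideanSpace ℝ (Fin d))
    (s t : ℝ) (n : ℕ) : EuclideanSpace ℝ (Fin m) :=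
  ∑ i ∈ Finset.range (2 ^ n), Matrix.toEuclideanLin (F (s + (i + 1 : ℕ) * ((t - s) / 2 ^ n)))
    (g (s + (i + 1 : ℕ) * ((t - s) / 2 ^ n)) - g (s + (i : ℕ) * ((t - s) / 2 ^ n)))

theorem HasRSIntegral.tendsto_dyadicSum {m d : ℕ} {F : ℝ → Matrix (Fin m) (Fin d) ℝ}
    {g : ℝ → EuclideanSpace ℝ (Fin d)} {s t : ℝ} {I : EuclideanSpace ℝ (Fin m)}
    (hst : s ≤ t) (hI : HasRSIntegral F g s t I) :
    Tendsto (dyadicSum F g s t) atTop (𝓝 I) := by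
  rw [Metric.tendsto_atTop]
  intro ε hε
  obtain ⟨η, hη, h⟩ := hI ε hε
  have hlim : Tendsto (fun n : ℕ => (t - s) / 2 ^ n) atTop (𝓝 0) :=
    tendsto_const_nhds.div_atTop (tendsto_pow_atTop_atTop_of_one_lt one_lt_two)
  obtain ⟨N, hN⟩ := eventually_atTop.1 (hlim.eventually (gt_mem_nhds hη))
  refine ⟨N, fun n hn => ?_⟩
  have hpos : 0 ≤ (t - s) / 2 ^ n := div_nonneg (by linarith) (by positivity)
  rw [dist_eq_norm]
  refine h (2 ^ n) (fun i => s + (i : ℕ) * ((t - s) / 2 ^ n))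
    (fun i => s + (i + 1 : ℕ) * ((t - s) / 2 ^ n)) (by simp) ?_ (fun i _ => ⟨?_, le_rfl, ?_⟩)
  · push_cast; field_simp; ring
  · push_cast; linarith
  · have := hN n hn
    push_cast; linarith

/-- Refining a dyadic sum once changes it by a geometrically small amount. The tags avoid `s`,
so `F` only has to be Hölder continuous on `(s, t]`. -/
theorem dist_dyadicSum_succ_le {m d : ℕ} {F : ℝ → Matrix (Fin m) (Fin d) ℝ}
    {g : ℝ → EuclideanSpace ℝ (Fin d)} {s t α β δ c G : ℝ} (hst : s < t)
    (hc : 0 ≤ c) (hδ : 0 < δ) (hαβ : α + β = 1 + δ)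
    (hF : ∀ u ∈ Ioc s t, ∀ v ∈ Ioc s t, u ≤ v → ‖F v - F u‖ ≤ c * (v - u) ^ α)
    (hg : ∀ u ∈ Icc s t, ∀ v ∈ Icc s t, u ≤ v → ‖g v - g u‖ ≤ G * (v - u) ^ β) (n : ℕ) :
    dist (dyadicSum F g s t n) (dyadicSum F g s t (n + 1)) ≤
      c * G * (t - s) ^ (1 + δ) * ((2 : ℝ) ^ (-δ)) ^ n := by
  set h : ℝ := (t - s) / 2 ^ (n + 1) with hh
  have hh0 : 0 < h := div_pos (by linarith) (by positivity)
  have hh2 : (t - s) / 2 ^ n = 2 * h := by rw [hh, pow_succ]; field_simp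
  have htot : (2 : ℝ) ^ n * (2 * h) = t - s := by rw [← hh2]; field_simp
  rw [dist_eq_norm]
  unfold dyadicSum
  rw [pow_succ', Finset.sum_range_two_mul, ← Finset.sum_sub_distrib, ← hh, hh2]
  have hterm : ∀ i ∈ Finset.range (2 ^ n),
      ‖Matrix.toEuclideanLin (F (s + (i + 1 : ℕ) * (2 * h)))
          (g (s + (i + 1 : ℕ) * (2 * h)) - g (s + (i : ℕ) * (2 * h))) -
        (Matrix.toEuclideanLin (F (s + (2 * i + 1 : ℕ) * h))
          (g (s + (2 * i + 1 : ℕ) * h) - g (s + (2 * i : ℕ) * h)) +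
        Matrix.toEuclideanLin (F (s + (2 * i + 1 + 1 : ℕ) * h))
          (g (s + (2 * i + 1 + 1 : ℕ) * h) - g (s + (2 * i + 1 : ℕ) * h)))‖
      ≤ c * G * h ^ (1 + δ) := by
    intro i hi
    have hi : ((i : ℝ) + 1) ≤ 2 ^ n := by exact_mod_cast Finset.mem_range.1 hi
    have hi0 : (0 : ℝ) ≤ i := Nat.cast_nonneg _
    have hle : (i + 1 : ℝ) * (2 * h) ≤ t - s := by
      rw [← htot]; gcongr
    have hih : 0 ≤ i * h := by positivity
    have e0 : s + (2 * i : ℕ) * h = s + (i : ℕ) * (2 * h) := by push_cast; ring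
    have e2 : s + (2 * i + 1 + 1 : ℕ) * h = s + (i + 1 : ℕ) * (2 * h) := by push_cast; ring
    rw [e0, e2]
    set p := s + (i : ℕ) * (2 * h) with hp
    have e1 : s + (2 * i + 1 : ℕ) * h = p + h := by rw [hp]; push_cast; ring
    have e3 : s + (i + 1 : ℕ) * (2 * h) = p + 2 * h := by rw [hp]; push_cast; ring
    rw [e1, e3]
    have hps : s ≤ p := by rw [hp]; linarith
    have hpt : p + 2 * h ≤ t := by rw [hp]; linarith
    have halg : Matrix.toEuclideanLin (F (p + 2 * h)) (g (p + 2 * h) - g p) -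
        (Matrix.toEuclideanLin (F (p + h)) (g (p + h) - g p) +
          Matrix.toEuclideanLin (F (p + 2 * h)) (g (p + 2 * h) - g (p + h))) =
        Matrix.toEuclideanLin (F (p + 2 * h) - F (p + h)) (g (p + h) - g p) := by
      simp only [map_sub, LinearMap.sub_apply]; abel
    rw [halg]
    have h1 := hF (p + h) ⟨by linarith, by linarith⟩ (p + 2 * h) ⟨by linarith, hpt⟩ (by linarith)
    have h2 := hg p ⟨hps, by linarith⟩ (p + h) ⟨by linarith, by linarith⟩ (by linarith)
    have e4 : p + 2 * h - (p + h) = h := by ring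
    have e5 : p + h - p = h := by ring
    rw [e4] at h1
    rw [e5] at h2
    calc _ ≤ ‖F (p + 2 * h) - F (p + h)‖ * ‖g (p + h) - g p‖ := norm_toEuclideanLin_le _ _
      _ ≤ (c * h ^ α) * (G * h ^ β) := by gcongr
      _ = c * G * h ^ (1 + δ) := by rw [← hαβ, Real.rpow_add hh0]; ring
  refine (norm_sum_le_of_le _ hterm).trans ?_
  have hG : 0 ≤ G := by
    have := (norm_nonneg _).trans (hg s ⟨le_rfl, hst.le⟩ t ⟨hst.le, le_rfl⟩ hst.le)
    exact nonneg_of_mul_nonneg_left this (Real.rpow_pos_of_pos (by linarith) _)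
  rw [Finset.sum_const, Finset.card_range, nsmul_eq_mul]
  have hkey : ((2 ^ n : ℕ) : ℝ) * h ^ (1 + δ) ≤ (t - s) ^ (1 + δ) * ((2 : ℝ) ^ (-δ)) ^ n := by
    have hle : h ≤ (t - s) / 2 ^ n := by rw [hh2]; linarith
    calc ((2 ^ n : ℕ) : ℝ) * h ^ (1 + δ) ≤ 2 ^ n * ((t - s) / 2 ^ n) ^ (1 + δ) := by
          push_cast; gcongr
      _ = (t - s) ^ (1 + δ) * ((2 : ℝ) ^ (-δ)) ^ n := by
          rw [Real.div_rpow (by linarith) (by positivity), Real.rpow_add (by positivity : (0:ℝ) < 2 ^ n),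
            Real.rpow_one, Real.rpow_neg zero_le_two, inv_pow, ← Real.rpow_natCast_mul zero_le_two,
            ← Real.rpow_mul_natCast zero_le_two, mul_comm δ]
          field_simp
  calc ((2 ^ n : ℕ) : ℝ) * (c * G * h ^ (1 + δ)) = c * G * (((2 ^ n : ℕ) : ℝ) * h ^ (1 + δ)) := by
        ring
    _ ≤ c * G * ((t - s) ^ (1 + δ) * ((2 : ℝ) ^ (-δ)) ^ n) := by gcongr
    _ = _ := by ring

/-- Young's estimate, with the integrand frozen at the right end point. -/
theorem HasRSIntegral.norm_sub_le {m d : ℕ} {F : ℝ → Matrix (Fin m) (Fin d) ℝ}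
    {g : ℝ → EuclideanSpace ℝ (Fin d)} {s t α β δ c G : ℝ} {I : EuclideanSpace ℝ (Fin m)}
    (hst : s < t) (hc : 0 ≤ c) (hδ : 0 < δ) (hαβ : α + β = 1 + δ)
    (hF : ∀ u ∈ Ioc s t, ∀ v ∈ Ioc s t, u ≤ v → ‖F v - F u‖ ≤ c * (v - u) ^ α)
    (hg : ∀ u ∈ Icc s t, ∀ v ∈ Icc s t, u ≤ v → ‖g v - g u‖ ≤ G * (v - u) ^ β)
    (hI : HasRSIntegral F g s t I) :
    ‖I - Matrix.toEuclideanLin (F t) (g t - g s)‖ ≤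
      c * G * (t - s) ^ (1 + δ) / (1 - (2 : ℝ) ^ (-δ)) := by
  have hr : (2 : ℝ) ^ (-δ) < 1 := Real.rpow_lt_one_of_one_lt_of_neg one_lt_two (by linarith)
  have h := dist_le_of_le_geometric_of_tendsto₀ _ _ hr
    (dist_dyadicSum_succ_le hst hc hδ hαβ hF hg) (hI.tendsto_dyadicSum hst.le)
  rwa [dist_comm, dist_eq_norm, show dyadicSum F g s t 0 =
    Matrix.toEuclideanLin (F t) (g t - g s) by simp [dyadicSum]] at h

/-! ### Regularity of functions in `W_0^{α,∞}` -/

section SobolevRegularity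

variable {E : Type*} [NormedAddCommGroup E] [MeasurableSpace E]

theorem MemW0.exists_bound {α : ℝ} {x : ℝ → E} (hx : MemW0 α x) :
    ∃ A : ℝ, 0 ≤ A ∧ (∀ t ∈ Icc (0 : ℝ) 1, ‖x t‖ ≤ A) ∧ ∀ t ∈ Icc (0 : ℝ) 1,
      ∫⁻ s in Ioo 0 t, ENNReal.ofReal (‖x t - x s‖ / (t - s) ^ (α + 1)) ≤ ENNReal.ofReal A := by
  set B : ENNReal := ⨆ t ∈ Icc (0 : ℝ) 1, (ENNReal.ofReal ‖x t‖ +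
    ∫⁻ s in Ioo 0 t, ENNReal.ofReal (‖x t - x s‖ / (t - s) ^ (α + 1))) with hB
  have hBtop : B ≠ ⊤ := hx.2.ne
  have hle : ∀ t ∈ Icc (0 : ℝ) 1, ENNReal.ofReal ‖x t‖ +
      ∫⁻ s in Ioo 0 t, ENNReal.ofReal (‖x t - x s‖ / (t - s) ^ (α + 1)) ≤ B := fun t ht =>
    le_iSup₂ (f := fun t (_ : t ∈ Icc (0 : ℝ) 1) => ENNReal.ofReal ‖x t‖ +
      ∫⁻ s in Ioo 0 t, ENNReal.ofReal (‖x t - x s‖ / (t - s) ^ (α + 1))) t ht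
  refine ⟨B.toReal, ENNReal.toReal_nonneg, fun t ht => ?_, fun t ht => ?_⟩
  · exact (ENNReal.ofReal_le_iff_le_toReal hBtop).1 (le_self_add.trans (hle t ht))
  · rw [ENNReal.ofReal_toReal hBtop]
    exact le_add_self.trans (hle t ht)

variable [BorelSpace E]

/-- Comparing `x t` and `x s` with the average of `x` over an interval of length `t - s` to the
left of `s` bounds their difference. -/
theorem MemW0.norm_sub_le_of_sub_le {α A : ℝ} {x : ℝ → E} (hα : 0 < α) (hx : MemW0 α x)
    (hA : 0 ≤ A) (hxA : ∀ t ∈ Icc (0 : ℝ) 1,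
      ∫⁻ s in Ioo 0 t, ENNReal.ofReal (‖x t - x s‖ / (t - s) ^ (α + 1)) ≤ ENNReal.ofReal A)
    {s t : ℝ} (hst : s < t) (ht : t ≤ 1) (hs : t - s ≤ s) :
    ‖x t - x s‖ ≤ 2 ^ (α + 1) * (2 * A) * (t - s) ^ α := by
  set h := t - s with hh
  have hh0 : 0 < h := by linarith
  set φ : ℝ → ℝ → ENNReal := fun t r => ENNReal.ofReal (‖x t - x r‖ / (t - r) ^ (α + 1)) with hφ
  have hJ : Ioo (s - h) s ⊆ Icc 0 1 := fun r hr => ⟨by linarith [hr.1], by linarith [hr.2]⟩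
  have hxm : AEMeasurable x (volume.restrict (Ioo (s - h) s)) :=
    hx.1.mono_measure (Measure.restrict_mono hJ le_rfl)
  have hφm : ∀ t, AEMeasurable (φ t) (volume.restrict (Ioo (s - h) s)) := fun t =>
    ((hxm.const_sub (x t)).norm.div
      (by fun_prop : Measurable fun r : ℝ => (t - r) ^ (α + 1)).aemeasurable).ennreal_ofReal
  have hpt : ∀ r ∈ Ioo (s - h) s, ENNReal.ofReal ‖x t - x s‖ ≤
      ENNReal.ofReal ((2 * h) ^ (α + 1)) * (φ t r + φ s r) := by
    intro r hr
    have key : ∀ u, r < u → u - r ≤ 2 * h →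
        ‖x u - x r‖ ≤ (2 * h) ^ (α + 1) * (‖x u - x r‖ / (u - r) ^ (α + 1)) := by
      intro u hu hu2
      have h0 : 0 < (u - r) ^ (α + 1) := Real.rpow_pos_of_pos (by linarith) _
      rw [mul_div_assoc', le_div_iff₀ h0, mul_comm]
      gcongr
    have hdiv : ∀ u, r < u → 0 ≤ ‖x u - x r‖ / (u - r) ^ (α + 1) := fun u hu =>
      div_nonneg (norm_nonneg _) (Real.rpow_nonneg (by linarith) _)
    have htr : r < t := by linarith [hr.2]
    simp only [hφ]
    rw [← ENNReal.ofReal_add (hdiv t htr) (hdiv s hr.2), ← ENNReal.ofReal_mul (by positivity)]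
    refine ENNReal.ofReal_le_ofReal ?_
    calc ‖x t - x s‖ = ‖(x t - x r) - (x s - x r)‖ := by congr 1; abel
      _ ≤ ‖x t - x r‖ + ‖x s - x r‖ := norm_sub_le _ _
      _ ≤ _ := add_le_add (key t htr (by linarith [hr.1])) (key s hr.2 (by linarith [hr.1]))
      _ = _ := by ring
  have hint : ENNReal.ofReal ‖x t - x s‖ * ENNReal.ofReal h ≤
      ENNReal.ofReal ((2 * h) ^ (α + 1)) * (ENNReal.ofReal A + ENNReal.ofReal A) := by
    calc ENNReal.ofReal ‖x t - x s‖ * ENNReal.ofReal h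
        = ∫⁻ _ in Ioo (s - h) s, ENNReal.ofReal ‖x t - x s‖ := by
          rw [setLIntegral_const, Real.volume_Ioo]; congr 2; ring
      _ ≤ ∫⁻ r in Ioo (s - h) s, ENNReal.ofReal ((2 * h) ^ (α + 1)) * (φ t r + φ s r) :=
          setLIntegral_mono' measurableSet_Ioo hpt
      _ = ENNReal.ofReal ((2 * h) ^ (α + 1)) *
          ((∫⁻ r in Ioo (s - h) s, φ t r) + ∫⁻ r in Ioo (s - h) s, φ s r) := by
          rw [lintegral_const_mul' _ _ ENNReal.ofReal_ne_top, lintegral_add_left' (hφm t)]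
      _ ≤ _ := by
          gcongr
          · exact (lintegral_mono_set (Ioo_subset_Ioo (by linarith) hst.le)).trans
              (hxA t ⟨by linarith, ht⟩)
          · exact (lintegral_mono_set (Ioo_subset_Ioo (by linarith) le_rfl)).trans
              (hxA s ⟨by linarith, by linarith⟩)
  rw [← ENNReal.ofReal_add hA hA, ← ENNReal.ofReal_mul (norm_nonneg _),
    ← ENNReal.ofReal_mul (by positivity), ENNReal.ofReal_le_ofReal_iff (by positivity),
    Real.mul_rpow zero_le_two hh0.le, Real.rpow_add_one hh0.ne'] at hint
  refine le_of_mul_le_mul_right ?_ hh0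
  linarith

/-- Functions in `W_0^{α,∞}` are `α`-Hölder continuous on `(0, 1]`; nothing is said at `0`, where
the defining integral is empty. Points far apart relative to their distance to `0` are joined
through `t, t / 2, t / 4, …`. -/
theorem MemW0.exists_holder {α : ℝ} {x : ℝ → E} (hα : 0 < α) (hx : MemW0 α x) :
    ∃ D : ℝ, 0 ≤ D ∧ ∀ s t : ℝ, 0 < s → s ≤ t → t ≤ 1 → ‖x t - x s‖ ≤ D * (t - s) ^ α := by
  obtain ⟨A, hA, -, hxA⟩ := hx.exists_bound
  set C : ℝ := 2 ^ (α + 1) * (2 * A)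
  have hC : 0 ≤ C := by positivity
  have hnear : ∀ s t : ℝ, s < t → t ≤ 1 → t - s ≤ s → ‖x t - x s‖ ≤ C * (t - s) ^ α :=
    fun s t hst ht hs => hx.norm_sub_le_of_sub_le hα hA hxA hst ht hs
  have h2 : 1 < (2 : ℝ) ^ α := Real.one_lt_rpow one_lt_two hα
  -- `D` solves `C + D = D * 2 ^ α`, the fixed point of the halving recursion
  set D : ℝ := C / (2 ^ α - 1) with hD
  have hD0 : 0 ≤ D := div_nonneg hC (by linarith)
  have hCD : C + D = D * 2 ^ α := by
    have : (2 : ℝ) ^ α - 1 ≠ 0 := by linarith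
    rw [hD]; field_simp; ring
  have hhalf : ∀ t : ℝ, 0 < t → C * (t / 2) ^ α + D * (t / 2) ^ α = D * t ^ α := by
    intro t ht
    rw [← add_mul, hCD, Real.div_rpow ht.le zero_le_two]
    field_simp
  have hfar : ∀ k : ℕ, ∀ s t : ℝ, 0 < s → s ≤ t → t ≤ 1 → t ≤ s * 2 ^ k →
      ‖x t - x s‖ ≤ D * t ^ α := by
    intro k
    induction k with
    | zero =>
      intro s t hs hst _ hk
      have : s = t := le_antisymm hst (by simpa using hk)
      have ht : 0 < t := by linarith
      rw [this, sub_self, norm_zero]; positivity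
    | succ k ih =>
      intro s t hs hst ht hk
      have ht0 : 0 < t := by linarith
      rcases lt_or_ge s (t / 2) with h | h
      · have h1 := ih s (t / 2) hs h.le (by linarith) (by rw [pow_succ] at hk; linarith)
        have h2 := hnear (t / 2) t (by linarith) ht (by linarith)
        rw [sub_half] at h2
        rw [← hhalf t ht0]
        calc ‖x t - x s‖ ≤ ‖x t - x (t / 2)‖ + ‖x (t / 2) - x s‖ := norm_sub_le_norm_sub_add_norm_sub _ _ _
          _ ≤ _ := add_le_add h2 h1
      · rcases hst.eq_or_lt with rfl | hlt
        · rw [sub_self, norm_zero]; positivity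
        · have h1 := hnear s t hlt ht (by linarith)
          have h3 : (t - s) ^ α ≤ (t / 2) ^ α :=
            Real.rpow_le_rpow (by linarith) (by linarith) hα.le
          have h4 : 0 ≤ D * (t / 2) ^ α := by positivity
          rw [← hhalf t ht0]
          nlinarith [mul_le_mul_of_nonneg_left h3 hC]
  refine ⟨C + D * 2 ^ α, by positivity, fun s t hs hst ht => ?_⟩
  rcases hst.eq_or_lt with rfl | hlt
  · rw [sub_self, norm_zero]
    exact mul_nonneg (by positivity) (Real.rpow_nonneg (by simp) _)
  have hpow : 0 ≤ (t - s) ^ α := Real.rpow_nonneg (by linarith) _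
  rw [add_mul]
  rcases le_or_gt (t - s) s with h | h
  · exact (hnear s t hlt ht h).trans (le_add_of_nonneg_right (by positivity))
  · obtain ⟨k, hk⟩ := pow_unbounded_of_one_lt (t / s) one_lt_two
    rw [div_lt_iff₀ hs] at hk
    have h1 := hfar k s t hs hst ht (by linarith)
    have h3 : t ^ α ≤ 2 ^ α * (t - s) ^ α := by
      rw [← Real.mul_rpow zero_le_two (by linarith)]
      exact Real.rpow_le_rpow (by linarith) (by linarith) hα.le
    have h4 : 0 ≤ C * (t - s) ^ α := by positivity
    nlinarith [mul_le_mul_of_nonneg_left h3 hD0]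

end SobolevRegularity

/-! ### A priori bounds from a self-improving increment estimate -/

section APriori

variable {E : Type*} [NormedAddCommGroup E]

theorem IsHolder.norm_sub_le {β : ℝ} {f : ℝ → E} (hf : IsHolder β f) {s t : ℝ}
    (hs : 0 ≤ s) (hst : s < t) (ht : t ≤ 1) : ‖f t - f s‖ ≤ holderNorm β f * (t - s) ^ β := by
  have hpos : ∀ {s t : ℝ}, s < t → 0 < |t - s| ^ β := fun h =>
    Real.rpow_pos_of_pos (abs_pos.2 (by linarith)) _
  obtain ⟨C, hC⟩ := hf
  have hbdd : BddAbove {y : ℝ | ∃ s t : ℝ, 0 ≤ s ∧ s < t ∧ t ≤ 1 ∧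
      y = ‖f t - f s‖ / |t - s| ^ β} := by
    refine ⟨C, ?_⟩
    rintro y ⟨s, t, hs, hst, ht, rfl⟩
    rw [div_le_iff₀ (hpos hst)]
    exact hC s ⟨hs, by linarith⟩ t ⟨by linarith, ht⟩
  have h := le_csSup hbdd ⟨s, t, hs, hst, ht, rfl⟩
  rw [div_le_iff₀ (hpos hst), abs_of_pos (sub_pos.2 hst)] at h
  exact h

theorem holderNorm_nonneg (β : ℝ) (f : ℝ → E) : 0 ≤ holderNorm β f := by
  refine Real.sSup_nonneg ?_
  rintro y ⟨s, t, -, -, -, rfl⟩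
  positivity

theorem holderNorm_le {β C : ℝ} {f : ℝ → E}
    (h : ∀ s t, 0 ≤ s → s < t → t ≤ 1 → ‖f t - f s‖ ≤ C * (t - s) ^ β) : holderNorm β f ≤ C := by
  refine csSup_le ⟨_, 0, 1, le_rfl, one_pos, le_rfl, rfl⟩ ?_
  rintro y ⟨s, t, hs, hst, ht, rfl⟩
  rw [abs_of_pos (sub_pos.2 hst), div_le_iff₀ (Real.rpow_pos_of_pos (by linarith) _)]
  exact h s t hs hst ht

theorem isHolder_of_lt {β C : ℝ} {f : ℝ → E} (hC : 0 ≤ C)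
    (h : ∀ s t, 0 ≤ s → s < t → t ≤ 1 → ‖f t - f s‖ ≤ C * (t - s) ^ β) : IsHolder β f := by
  refine ⟨C, fun s hs t ht => ?_⟩
  rcases lt_trichotomy s t with hst | rfl | hst
  · rw [abs_of_pos (sub_pos.2 hst)]
    exact h s t hs.1 hst ht.2
  · rw [sub_self, norm_zero]; positivity
  · rw [norm_sub_rev, abs_sub_comm, abs_of_pos (sub_pos.2 hst)]
    exact h t s ht.1 hst hs.2

/-- The increment estimate that Young's inequality gives for a solution: if, on `[s, t]`, `x` is
bounded by `A` and is `α`-Hölder continuous with constant `N` away from the left end point, then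
`x t - x s` is controlled by `Q`, `A` and `N`. -/
def IncrementEstimate (α Q : ℝ) (x : ℝ → E) : Prop :=
  ∀ s t A N : ℝ, 0 ≤ s → s < t → t ≤ 1 → 0 ≤ N → (∀ r ∈ Icc s t, ‖x r‖ ≤ A) →
    (∀ u ∈ Ioc s t, ∀ v ∈ Ioc s t, u ≤ v → ‖x v - x u‖ ≤ N * (v - u) ^ α) →
    ‖x t - x s‖ ≤ Q * (1 + A) * (t - s) ^ (1 - α) + Q * N * (t - s)

variable {α Q Δ : ℝ} {x : ℝ → E}

/-- On an interval so short that `Q * (b - a) ^ (1 - α) ≤ 1 / 4`, the Hölder constant is absorbed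
into the left-hand side of the increment estimate. -/
theorem IncrementEstimate.local_holder (hx : IncrementEstimate α Q x) (hα : α < 1 / 2) (hQ : 0 < Q)
    (hΔ : Q * Δ ^ (1 - α) = 1 / 4) (hH : IsHolder (1 - α) x)
    {a b A : ℝ} (ha : 0 ≤ a) (hb : b ≤ 1) (hab : b - a ≤ Δ) (hA : ∀ r ∈ Icc a b, ‖x r‖ ≤ A)
    {s t : ℝ} (hs : a ≤ s) (hst : s < t) (ht : t ≤ b) :
    ‖x t - x s‖ ≤ 2 * Q * (1 + A) * (t - s) ^ (1 - α) := by
  have hA0 : 0 ≤ A := (norm_nonneg _).trans (hA s ⟨hs, by linarith⟩)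
  have hpos : ∀ {s t : ℝ}, s < t → 0 < (t - s) ^ (1 - α) := fun h =>
    Real.rpow_pos_of_pos (by linarith) _
  set S : Set ℝ := {y | ∃ u v, a ≤ u ∧ u < v ∧ v ≤ b ∧ y = ‖x v - x u‖ / (v - u) ^ (1 - α)} with hS
  have hbdd : BddAbove S := by
    refine ⟨holderNorm (1 - α) x, ?_⟩
    rintro y ⟨u, v, hu, huv, hv, rfl⟩
    rw [div_le_iff₀ (hpos huv)]
    exact hH.norm_sub_le (by linarith) huv (by linarith)
  set N := sSup S with hN
  have hmem : ∀ u v, a ≤ u → u < v → v ≤ b → ‖x v - x u‖ ≤ N * (v - u) ^ (1 - α) := by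
    intro u v hu huv hv
    rw [← div_le_iff₀ (hpos huv)]
    exact le_csSup hbdd ⟨u, v, hu, huv, hv, rfl⟩
  have hN0 : 0 ≤ N := by
    refine Real.sSup_nonneg ?_
    rintro y ⟨u, v, -, huv, -, rfl⟩
    exact div_nonneg (norm_nonneg _) (hpos huv).le
  have hNle : N ≤ Q * (1 + A) + N / 4 := by
    refine csSup_le ⟨_, s, t, hs, hst, ht, rfl⟩ ?_
    rintro y ⟨u, v, hu, huv, hv, rfl⟩
    rw [div_le_iff₀ (hpos huv)]
    have huv0 : 0 < v - u := by linarith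
    have h := hx u v A (N * (v - u) ^ (1 - 2 * α)) (by linarith) huv (by linarith) (by positivity)
      (fun r hr => hA r ⟨by linarith [hr.1], by linarith [hr.2]⟩) (by
        intro p hp q hq hpq
        rcases hpq.eq_or_lt with rfl | hpq
        · rw [sub_self, norm_zero]
          exact mul_nonneg (by positivity) (Real.rpow_nonneg (by simp) _)
        refine (hmem p q (by linarith [hp.1]) hpq (by linarith [hq.2])).trans ?_
        rw [mul_assoc, show 1 - α = (1 - 2 * α) + α by ring, Real.rpow_add (by linarith)]
        have : (q - p) ^ (1 - 2 * α) ≤ (v - u) ^ (1 - 2 * α) :=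
          Real.rpow_le_rpow (by linarith) (by linarith [hp.1, hq.2]) (by linarith)
        have h0 : 0 ≤ (q - p) ^ α := Real.rpow_nonneg (by linarith) _
        gcongr)
    have hsplit : (v - u) ^ (1 - 2 * α) * (v - u) = (v - u) ^ (1 - α) * (v - u) ^ (1 - α) := by
      rw [← Real.rpow_add_one huv0.ne', ← Real.rpow_add huv0]; congr 1; ring
    have hle : Q * (v - u) ^ (1 - α) ≤ 1 / 4 := by
      rw [← hΔ]
      have := Real.rpow_le_rpow huv0.le (by linarith : v - u ≤ Δ) (by linarith : 0 ≤ 1 - α)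
      gcongr
    have hp := hpos huv
    calc ‖x v - x u‖ ≤ _ := h
      _ = Q * (1 + A) * (v - u) ^ (1 - α)
          + N * (v - u) ^ (1 - α) * (Q * (v - u) ^ (1 - α)) := by
          linear_combination Q * N * hsplit
      _ ≤ Q * (1 + A) * (v - u) ^ (1 - α) + N * (v - u) ^ (1 - α) * (1 / 4) := by gcongr
      _ = _ := by ring
  refine (hmem s t hs hst ht).trans ?_
  have h1 : 0 ≤ Q * (1 + A) := by positivity
  have h2 : N ≤ 2 * Q * (1 + A) := by linarith
  have := (hpos hst).le
  gcongr

theorem IsHolder.continuousOn {β : ℝ} (hβ : 0 < β) {f : ℝ → E} (hf : IsHolder β f) :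
    ContinuousOn f (Icc 0 1) := by
  obtain ⟨C, hC⟩ := hf
  intro s hs
  rw [ContinuousWithinAt, tendsto_iff_norm_sub_tendsto_zero]
  have hc : Continuous fun t : ℝ => C * |t - s| ^ β :=
    continuous_const.mul ((continuous_abs.comp (continuous_sub_right s)).rpow_const
      fun _ => Or.inr hβ.le)
  have hlim : Tendsto (fun t => C * |t - s| ^ β) (𝓝[Icc 0 1] s) (𝓝 0) := by
    have := hc.tendsto s
    rw [sub_self, abs_zero, Real.zero_rpow hβ.ne', mul_zero] at this
    exact this.mono_left nhdsWithin_le_nhds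
  refine squeeze_zero' (Eventually.of_forall fun _ => norm_nonneg _) ?_ hlim
  filter_upwards [self_mem_nhdsWithin] with t ht using hC s hs t ht

/-- `1 + ‖x‖` at most doubles over an interval of length `Δ`. -/
theorem IncrementEstimate.one_add_norm_le (hx : IncrementEstimate α Q x) (hα : α < 1 / 2)
    (hQ : 0 < Q) (hΔ : Q * Δ ^ (1 - α) = 1 / 4) (hH : IsHolder (1 - α) x)
    {a b : ℝ} (ha : 0 ≤ a) (hab : a ≤ b) (hb : b ≤ 1) (habΔ : b - a ≤ Δ) :
    1 + ‖x b‖ ≤ 2 * (1 + ‖x a‖) := by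
  obtain ⟨c, hc, hmax⟩ := isCompact_Icc.exists_isMaxOn (nonempty_Icc.2 hab)
    ((hH.continuousOn (by linarith)).mono (Icc_subset_Icc ha hb)).norm
  have hmax : ∀ r ∈ Icc a b, ‖x r‖ ≤ ‖x c‖ := fun r hr => hmax hr
  have hca : ‖x c - x a‖ ≤ (1 + ‖x c‖) / 2 := by
    rcases hc.1.eq_or_lt with rfl | hlt
    · rw [sub_self, norm_zero]; positivity
    refine (hx.local_holder hα hQ hΔ hH ha hb habΔ hmax le_rfl hlt hc.2).trans ?_
    have h1 : (c - a) ^ (1 - α) ≤ Δ ^ (1 - α) :=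
      Real.rpow_le_rpow (by linarith) (by linarith [hc.2]) (by linarith)
    calc 2 * Q * (1 + ‖x c‖) * (c - a) ^ (1 - α) ≤ 2 * Q * (1 + ‖x c‖) * Δ ^ (1 - α) := by gcongr
      _ = (1 + ‖x c‖) / 2 := by linear_combination 2 * (1 + ‖x c‖) * hΔ
  have h1 := norm_le_norm_add_norm_sub' (x c) (x a)
  have h2 := hmax b ⟨hab, le_rfl⟩
  linarith

theorem IncrementEstimate.one_add_norm_le_two_pow (hx : IncrementEstimate α Q x) (hα : α < 1 / 2)
    (hQ : 0 < Q) (hΔ0 : 0 < Δ) (hΔ : Q * Δ ^ (1 - α) = 1 / 4) (hH : IsHolder (1 - α) x)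
    (n : ℕ) {t : ℝ} (ht0 : 0 ≤ t) (ht1 : t ≤ 1) (htn : t ≤ n * Δ) :
    1 + ‖x t‖ ≤ 2 ^ n * (1 + ‖x 0‖) := by
  induction n generalizing t with
  | zero =>
    have : t = 0 := le_antisymm (by simpa using htn) ht0
    simp [this]
  | succ n ih =>
    push_cast at htn
    have hn : 0 ≤ n * Δ := by positivity
    have h1 := ih (t := max 0 (t - Δ)) (le_max_left _ _) (max_le zero_le_one (by linarith))
      (max_le hn (by linarith))
    have h2 := hx.one_add_norm_le hα hQ hΔ hH (le_max_left 0 (t - Δ))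
      (max_le ht0 (by linarith)) ht1 (by linarith [le_max_right 0 (t - Δ)])
    rw [pow_succ]
    linarith

theorem IncrementEstimate.norm_le (hx : IncrementEstimate α Q x) (hα : α < 1 / 2)
    (hQ : 0 < Q) (hH : IsHolder (1 - α) x) {t : ℝ} (ht : t ∈ Icc (0 : ℝ) 1) :
    1 + ‖x t‖ ≤ 2 * Real.exp ((4 * Q) ^ (1 / (1 - α))) * (1 + ‖x 0‖) := by
  have hθ : 1 - α ≠ 0 := by linarith
  set R := (4 * Q) ^ (1 / (1 - α)) with hR
  have hR0 : 0 < R := by positivity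
  have hRθ : R ^ (1 - α) = 4 * Q := by
    rw [hR, ← Real.rpow_mul (by positivity), one_div_mul_cancel hθ, Real.rpow_one]
  have hΔ : Q * R⁻¹ ^ (1 - α) = 1 / 4 := by
    rw [Real.inv_rpow hR0.le, hRθ]; field_simp
  have hceil := Nat.le_ceil R
  have h := hx.one_add_norm_le_two_pow hα hQ (inv_pos.2 hR0) hΔ hH ⌈R⌉₊ ht.1 ht.2 (by
    rw [← div_eq_mul_inv]
    exact ht.2.trans ((one_le_div hR0).2 hceil))
  refine h.trans ?_
  gcongr
  calc (2 : ℝ) ^ ⌈R⌉₊ = 2 ^ (⌈R⌉₊ : ℝ) := (Real.rpow_natCast _ _).symm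
    _ ≤ 2 ^ (R + 1) := Real.rpow_le_rpow_of_exponent_le one_le_two (Nat.ceil_lt_add_one hR0.le).le
    _ = 2 * 2 ^ R := by rw [Real.rpow_add_one two_ne_zero, mul_comm]
    _ ≤ 2 * Real.exp R := by
      rw [← Real.exp_one_rpow R]
      have := Real.add_one_le_exp 1
      gcongr
      linarith

/-- Increments over times longer than `Δ` are bounded by `2 * A = 8 * Q * A * Δ ^ (1 - α)`. -/
theorem IncrementEstimate.norm_sub_le (hx : IncrementEstimate α Q x) (hα : α < 1 / 2)
    (hQ : 0 < Q) (hH : IsHolder (1 - α) x) {A : ℝ} (hA : ∀ r ∈ Icc (0 : ℝ) 1, ‖x r‖ ≤ A)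
    {s t : ℝ} (hs : 0 ≤ s) (hst : s < t) (ht : t ≤ 1) :
    ‖x t - x s‖ ≤ 8 * Q * (1 + A) * (t - s) ^ (1 - α) := by
  have hθ : 1 - α ≠ 0 := by linarith
  have hA0 : 0 ≤ A := (norm_nonneg _).trans (hA 0 ⟨le_rfl, zero_le_one⟩)
  set Δ := (1 / (4 * Q)) ^ (1 / (1 - α)) with hΔd
  have hΔ0 : 0 < Δ := by positivity
  have hΔ : Q * Δ ^ (1 - α) = 1 / 4 := by
    rw [hΔd, ← Real.rpow_mul (by positivity), one_div_mul_cancel hθ, Real.rpow_one]; field_simp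
  have hpos : 0 ≤ (t - s) ^ (1 - α) := Real.rpow_nonneg (by linarith) _
  rcases le_or_gt (t - s) Δ with h | h
  · refine (hx.local_holder hα hQ hΔ hH hs ht h
      (fun r hr => hA r ⟨by linarith [hr.1], by linarith [hr.2]⟩) le_rfl hst le_rfl).trans ?_
    gcongr
    norm_num
  · have h1 : Δ ^ (1 - α) ≤ (t - s) ^ (1 - α) := Real.rpow_le_rpow hΔ0.le h.le (by linarith)
    calc ‖x t - x s‖ ≤ ‖x t‖ + ‖x s‖ := _root_.norm_sub_le _ _
      _ ≤ A + A := add_le_add (hA t ⟨by linarith, ht⟩) (hA s ⟨hs, by linarith⟩)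
      _ ≤ 2 * (1 + A) := by linarith
      _ = 8 * Q * (1 + A) * Δ ^ (1 - α) := by linear_combination -8 * (1 + A) * hΔ
      _ ≤ _ := by gcongr

end APriori

/-! ### Solutions satisfy the increment estimate -/

section Solution

variable {m d : ℕ} {b : ℝ → EuclideanSpace ℝ (Fin m) → EuclideanSpace ℝ (Fin m)}
  {σ : ℝ → EuclideanSpace ℝ (Fin m) → Matrix (Fin m) (Fin d) ℝ}
  {g : ℝ → EuclideanSpace ℝ (Fin d)} {x₀ : EuclideanSpace ℝ (Fin m)}
  {x : ℝ → EuclideanSpace ℝ (Fin m)} {M L K lam gam : ℝ} {MN : ℝ → ℝ}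

theorem SigmaAssumption.norm_sub_le (hσ : SigmaAssumption M lam gam MN σ) (hM : 0 ≤ M)
    {s t : ℝ} (hs : s ∈ Icc (0 : ℝ) 1) (ht : t ∈ Icc (0 : ℝ) 1) (y z : EuclideanSpace ℝ (Fin m)) :
    ‖σ t y - σ s z‖ ≤ M * |t - s| ^ lam + M * ‖y - z‖ := by
  -- the time regularity is indexed by the coordinates of the space, so `m = 0` is separate
  rcases isEmpty_or_nonempty (Fin m) with hm | ⟨⟨i⟩⟩
  · rw [Subsingleton.elim (σ t y - σ s z) 0, norm_zero]; positivity
  · have h1 := hσ.time_holder y t ht s hs i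
    have h2 := hσ.lipschitz s hs y z
    have h3 := norm_nonneg (partialDeriv σ i t y - partialDeriv σ i s y)
    have h4 := norm_sub_le_norm_sub_add_norm_sub (σ t y) (σ s y) (σ s z)
    linarith

theorem SigmaAssumption.norm_le (hσ : SigmaAssumption M lam gam MN σ) (hM : 0 ≤ M) (hlam : 0 ≤ lam)
    (hK : ‖σ 0 0‖ ≤ K) {t : ℝ} (ht : t ∈ Icc (0 : ℝ) 1) (y : EuclideanSpace ℝ (Fin m)) :
    ‖σ t y‖ ≤ K + M + M * ‖y‖ := by
  have h := hσ.norm_sub_le hM ⟨le_rfl, zero_le_one⟩ ht y 0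
  rw [sub_zero, sub_zero, abs_of_nonneg ht.1] at h
  have h1 : M * t ^ lam ≤ M * 1 :=
    mul_le_mul_of_nonneg_left (Real.rpow_le_one ht.1 ht.2 hlam) hM
  have h2 := norm_le_norm_add_norm_sub' (σ t y) (σ 0 0)
  linarith

theorem IsSolution.exists_increment (hx : IsSolution b σ g x₀ x) {s t : ℝ} (hs : 0 ≤ s)
    (hst : s ≤ t) (ht : t ≤ 1) : ∃ I : EuclideanSpace ℝ (Fin m),
      HasRSIntegral (fun r => σ r (x r)) g s t I ∧ x t - x s = (∫ r in s..t, b r (x r)) + I := by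
  obtain ⟨hb, h⟩ := hx
  obtain ⟨I, hI, hxt⟩ := h t ⟨by linarith, ht⟩
  obtain ⟨J, hJ, hxs⟩ := h s ⟨hs, by linarith⟩
  refine ⟨I - J, hI.sub hs hJ, ?_⟩
  have hint : ∀ u ∈ Icc (0 : ℝ) 1, IntervalIntegrable (fun r => b r (x r)) volume 0 u :=
    fun u hu => hb.mono_set (by
      rw [uIcc_of_le hu.1, uIcc_of_le zero_le_one]; exact Icc_subset_Icc_right hu.2)
  rw [hxt, hxs, ← intervalIntegral.integral_interval_sub_left (hint t ⟨by linarith, ht⟩)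
    (hint s ⟨hs, by linarith⟩)]
  abel

theorem IsSolution.apply_zero (hx : IsSolution b σ g x₀ x) : x 0 = x₀ := by
  obtain ⟨I, hI, h⟩ := hx.2 0 ⟨le_rfl, zero_le_one⟩
  have hI0 : I = 0 := by
    by_contra hne
    obtain ⟨η, -, hη⟩ := hI ‖I‖ (norm_pos_iff.2 hne)
    simpa using hη 0 (fun _ => 0) (fun _ => 0) rfl rfl (by simp)
  simpa [hI0] using h

/-- Young's estimate for the integrand `σ(s, x_s)`, which is `α`-Hölder continuous because
`α ≤ λ`, against `g`, which is `(1 - α + δ)`-Hölder continuous. -/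
theorem IsSolution.incrementEstimate {α δ : ℝ} (hx : IsSolution b σ g x₀ x) (hM : 0 < M)
    (hL : 0 < L) (hb : DriftAssumption L b) (hσ : SigmaAssumption M lam gam MN σ)
    (hK : ‖σ 0 0‖ ≤ K) (hα : 0 < α) (hlam : α ≤ lam) (hδ : 0 < δ)
    (hg : IsHolder (1 - α + δ) g) :
    IncrementEstimate α
      ((L + K + M + M / (1 - (2 : ℝ) ^ (-δ))) * (1 + holderNorm (1 - α + δ) g)) x := by
  intro s t A N hs hst ht hN hA hxN
  have hr : (2 : ℝ) ^ (-δ) < 1 := Real.rpow_lt_one_of_one_lt_of_neg one_lt_two (by linarith)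
  have hr0 : 0 < 1 - (2 : ℝ) ^ (-δ) := by linarith
  set ρ := M / (1 - (2 : ℝ) ^ (-δ)) with hρ
  have hρ0 : 0 < ρ := div_pos hM hr0
  set G := holderNorm (1 - α + δ) g with hGd
  have hG0 : 0 ≤ G := holderNorm_nonneg _ _
  have hK0 : 0 ≤ K := (norm_nonneg _).trans hK
  have hA0 : 0 ≤ A := (norm_nonneg _).trans (hA s ⟨le_rfl, hst.le⟩)
  obtain ⟨I, hI, hinc⟩ := hx.exists_increment hs hst.le ht
  have h0 : 0 < t - s := by linarith
  have h1 : t - s ≤ 1 := by linarith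
  have hmem : ∀ r ∈ Icc s t, r ∈ Icc (0 : ℝ) 1 :=
    fun r hr => ⟨by linarith [hr.1], by linarith [hr.2]⟩
  have hgI : ∀ u ∈ Icc s t, ∀ v ∈ Icc s t, u ≤ v → ‖g v - g u‖ ≤ G * (v - u) ^ (1 - α + δ) := by
    intro u hu v hv huv
    rcases huv.eq_or_lt with rfl | huv
    · rw [sub_self, norm_zero]
      exact mul_nonneg hG0 (Real.rpow_nonneg (by simp) _)
    · exact hg.norm_sub_le (hmem u hu).1 huv (hmem v hv).2
  have hF : ∀ u ∈ Ioc s t, ∀ v ∈ Ioc s t, u ≤ v →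
      ‖σ v (x v) - σ u (x u)‖ ≤ M * (1 + N) * (v - u) ^ α := by
    intro u hu v hv huv
    have h2 := hσ.norm_sub_le hM.le (hmem u (Ioc_subset_Icc_self hu))
      (hmem v (Ioc_subset_Icc_self hv)) (x v) (x u)
    rw [abs_of_nonneg (sub_nonneg.2 huv)] at h2
    have h3 : (v - u) ^ lam ≤ (v - u) ^ α := Real.rpow_le_rpow_of_exponent_ge'
      (by linarith) (by linarith [hu.1, hv.2]) hα.le hlam
    calc _ ≤ _ := h2
      _ ≤ M * (v - u) ^ α + M * (N * (v - u) ^ α) := by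
        gcongr
        exact hxN u hu v hv huv
      _ = _ := by ring
  have hY := hI.norm_sub_le hst (by positivity) hδ (by ring) hF hgI
  have hFt : ‖Matrix.toEuclideanLin (σ t (x t)) (g t - g s)‖ ≤
      (K + M + M * A) * (G * (t - s) ^ (1 - α + δ)) := by
    refine (norm_toEuclideanLin_le _ _).trans ?_
    have h2 := hσ.norm_le hM.le (hα.le.trans hlam) hK (hmem t ⟨hst.le, le_rfl⟩) (x t)
    have h3 := hA t ⟨hst.le, le_rfl⟩
    have h4 := hgI s ⟨le_rfl, hst.le⟩ t ⟨hst.le, le_rfl⟩ hst.le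
    have h5 : ‖σ t (x t)‖ ≤ K + M + M * A := h2.trans (by gcongr)
    gcongr
  have hB : ‖∫ r in s..t, b r (x r)‖ ≤ L * (1 + A) * (t - s) := by
    have h2 := intervalIntegral.norm_integral_le_of_norm_le_const (a := s) (b := t)
      (f := fun r => b r (x r)) (C := L * (1 + A)) (by
        intro r hr
        rw [uIoc_of_le hst.le] at hr
        have hr' := Ioc_subset_Icc_self hr
        refine (hb.growth r (hmem r hr') (x r)).trans ?_
        gcongr
        exact hA r hr')
    rwa [abs_of_pos h0] at h2
  set θ := (t - s) ^ (1 - α) with hθ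
  have hθ0 : 0 < θ := Real.rpow_pos_of_pos h0 _
  have e1 : t - s ≤ θ := by
    have := Real.rpow_le_rpow_of_exponent_ge h0 h1 (by linarith : 1 - α ≤ 1)
    rwa [Real.rpow_one] at this
  have e2 : (t - s) ^ (1 - α + δ) ≤ θ :=
    Real.rpow_le_rpow_of_exponent_ge h0 h1 (by linarith)
  have e3 : (t - s) ^ (1 + δ) ≤ t - s := by
    have := Real.rpow_le_rpow_of_exponent_ge h0 h1 (by linarith : 1 ≤ 1 + δ)
    rwa [Real.rpow_one] at this
  have hY' : M * (1 + N) * G * (t - s) ^ (1 + δ) / (1 - (2 : ℝ) ^ (-δ)) =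
      ρ * (1 + N) * G * (t - s) ^ (1 + δ) := by rw [hρ]; ring
  have hI' : ‖I‖ ≤ (K + M + M * A) * G * θ + ρ * G * θ + ρ * N * G * (t - s) := by
    calc ‖I‖ ≤ _ := norm_le_norm_add_norm_sub' I
            (Matrix.toEuclideanLin (σ t (x t)) (g t - g s))
      _ ≤ (K + M + M * A) * (G * (t - s) ^ (1 - α + δ)) + ρ * (1 + N) * G * (t - s) ^ (1 + δ) := by
          rw [← hY']; exact add_le_add hFt hY
      _ ≤ (K + M + M * A) * (G * θ) + ρ * (1 + N) * G * (t - s) := by gcongr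
      _ = (K + M + M * A) * G * θ + ρ * G * (t - s) + ρ * N * G * (t - s) := by ring
      _ ≤ _ := by gcongr
  have hcoef : L * (1 + A) + (K + M + M * A) * G + ρ * G ≤
      (L + K + M + ρ) * (1 + G) * (1 + A) := by
    have : 0 ≤ (K + M + ρ) * (1 + A) + L * G * (1 + A) + K * G * A + ρ * G * A := by positivity
    linarith
  have hcoef' : ρ * N * G ≤ (L + K + M + ρ) * (1 + G) * N := by
    have : 0 ≤ (L + K + M) * (1 + G) * N + ρ * N := by positivity
    linarith
  calc ‖x t - x s‖ ≤ ‖∫ r in s..t, b r (x r)‖ + ‖I‖ := by rw [hinc]; exact norm_add_le _ _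
    _ ≤ L * (1 + A) * θ + ((K + M + M * A) * G * θ + ρ * G * θ + ρ * N * G * (t - s)) := by
        refine add_le_add (hB.trans ?_) hI'
        gcongr
    _ = (L * (1 + A) + (K + M + M * A) * G + ρ * G) * θ + ρ * N * G * (t - s) := by ring
    _ ≤ _ := by gcongr

/-- Membership in `W_0^{α,∞}` bounds `x` and makes it `α`-Hölder continuous on `(0, 1]`, and the
increment estimate raises the exponent to `1 - α` and includes the point `0`. -/
theorem IncrementEstimate.isHolder {α Q : ℝ} {x : ℝ → EuclideanSpace ℝ (Fin m)}
    (hQ : 0 ≤ Q) (hα : 0 < α) (hxW : MemW0 α x) (hx : IncrementEstimate α Q x) :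
    IsHolder (1 - α) x := by
  obtain ⟨A, hA0, hA, -⟩ := hxW.exists_bound
  obtain ⟨D, hD0, hD⟩ := hxW.exists_holder hα
  refine isHolder_of_lt (C := Q * (1 + A) + Q * D) (by positivity) fun s t hs hst ht => ?_
  have h := hx s t A D hs hst ht hD0 (fun r hr => hA r ⟨by linarith [hr.1], by linarith [hr.2]⟩)
    (fun u hu v hv huv => hD u v (by linarith [hu.1]) huv (by linarith [hv.2]))
  have e1 : t - s ≤ (t - s) ^ (1 - α) := by
    have := Real.rpow_le_rpow_of_exponent_ge (by linarith : 0 < t - s) (by linarith)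
      (by linarith : 1 - α ≤ 1)
    rwa [Real.rpow_one] at this
  calc _ ≤ _ := h
    _ ≤ Q * (1 + A) * (t - s) ^ (1 - α) + Q * D * (t - s) ^ (1 - α) := by gcongr
    _ = _ := by ring

end Solution

/-! ### The bounds in terms of the driving path -/

theorem one_add_rpow_le {G p : ℝ} (hG : 0 ≤ G) (hp : 0 ≤ p) :
    (1 + G) ^ p ≤ 2 ^ p * (1 + G ^ p) := by
  have hGp : 0 ≤ G ^ p := Real.rpow_nonneg hG p
  rcases le_total G 1 with h | h
  · calc (1 + G) ^ p ≤ 2 ^ p := Real.rpow_le_rpow (by linarith) (by linarith) hp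
      _ ≤ _ := le_mul_of_one_le_right (by positivity) (by linarith)
  · calc (1 + G) ^ p ≤ (2 * G) ^ p := Real.rpow_le_rpow (by linarith) (by linarith) hp
      _ = 2 ^ p * G ^ p := Real.mul_rpow zero_le_two hG
      _ ≤ _ := by gcongr; linarith

end YoungEq

theorem mainTheorem4 (m d : ℕ) (H : ℝ) (hH : 1 / 2 < H) (hH1 : H < 1)
    -- the constants of the assumption on the coefficients, and a bound `K` for `|σ(0,0)|`
    (M lam gam L K : ℝ) (MN : ℝ → ℝ) (hM : 0 < M) (hL : 0 < L) (hMN : ∀ N > 0, 0 < MN N)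
    (hlam : 1 - H < lam) (hlam1 : lam ≤ 1) (hgam : 1 / H - 1 < gam) (hgam1 : gam ≤ 1)
    (α δ : ℝ) (hα : 1 - H < α) (hα1 : α < min (1 / 2) (min lam (gam / (1 + gam))))
    (hδ : 0 < δ) (hδ1 : δ < α - (1 - H)) :
    ∃ C₁ C₂ C₃ : ℝ, 0 < C₁ ∧ 0 < C₂ ∧ 0 < C₃ ∧
      ∀ (b : ℝ → EuclideanSpace ℝ (Fin m) → EuclideanSpace ℝ (Fin m))
        (σ : ℝ → EuclideanSpace ℝ (Fin m) → Matrix (Fin m) (Fin d) ℝ),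
        YoungEq.DriftAssumption L b → YoungEq.SigmaAssumption M lam gam MN σ → ‖σ 0 0‖ ≤ K →
        ∀ g : ℝ → EuclideanSpace ℝ (Fin d),
          (∀ ε : ℝ, 0 < ε → ε < H → YoungEq.IsHolder (H - ε) g) →
          ∀ (x₀ : EuclideanSpace ℝ (Fin m)) (x : ℝ → EuclideanSpace ℝ (Fin m)),
            YoungEq.MemW0 α x → YoungEq.IsSolution b σ g x₀ x →
            YoungEq.IsHolder (1 - α) x ∧
            YoungEq.supNorm x ≤ C₁ * (1 + ‖x₀‖) *
              Real.exp (C₂ * YoungEq.holderNorm (1 - α + δ) g ^ (1 / (1 - α))) ∧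
            YoungEq.holderNorm (1 - α) x ≤ C₃ * (1 + ‖x₀‖) *
              (1 + YoungEq.holderNorm (1 - α + δ) g ^ (1 / (1 - α))) *
              (1 + YoungEq.holderNorm (1 - α + δ) g) *
              (1 + Real.exp (C₂ * YoungEq.holderNorm (1 - α + δ) g ^ (1 / (1 - α)))) := by
  have hα0 : 0 < α := by linarith
  have hα2 : α < 1 / 2 := hα1.trans_le (min_le_left _ _)
  have hαlam : α < lam := hα1.trans_le ((min_le_right _ _).trans (min_le_left _ _))
  have hθ : 0 < 1 - α := by linarith
  have hκ : 0 ≤ 1 / (1 - α) := by positivity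
  have hr : (2 : ℝ) ^ (-δ) < 1 := Real.rpow_lt_one_of_one_lt_of_neg one_lt_two (by linarith)
  -- `|K|` keeps the constants positive when no coefficient satisfies `‖σ 0 0‖ ≤ K`
  set c : ℝ := L + |K| + M + M / (1 - (2 : ℝ) ^ (-δ)) with hc
  have hc0 : 0 < c := by
    have : 0 < M / (1 - (2 : ℝ) ^ (-δ)) := div_pos hM (by linarith)
    positivity
  set C₂ : ℝ := (8 * c) ^ (1 / (1 - α)) with hC₂
  have hC₂0 : 0 < C₂ := by positivity
  refine ⟨2 * Real.exp C₂, C₂, 8 * c * (1 + 2 * Real.exp C₂), by positivity, hC₂0, by positivity,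
    fun b σ hb hσ hK g hg x₀ x hxW hx => ?_⟩
  have hgβ : YoungEq.IsHolder (1 - α + δ) g := by
    have := hg (H - (1 - α + δ)) (by linarith) (by linarith)
    rwa [sub_sub_cancel] at this
  have hinc := hx.incrementEstimate hM hL hb hσ (hK.trans (le_abs_self K)) hα0
    hαlam.le hδ hgβ
  rw [← hc] at hinc
  set G := YoungEq.holderNorm (1 - α + δ) g with hG
  have hG0 : 0 ≤ G := YoungEq.holderNorm_nonneg _ _
  have hQ : 0 < c * (1 + G) := by positivity
  have hxH : YoungEq.IsHolder (1 - α) x := hinc.isHolder hQ.le hα0 hxW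
  set P := G ^ (1 / (1 - α)) with hP
  have hP0 : 0 ≤ P := Real.rpow_nonneg hG0 _
  have hexp : (4 * (c * (1 + G))) ^ (1 / (1 - α)) ≤ C₂ + C₂ * P := by
    calc (4 * (c * (1 + G))) ^ (1 / (1 - α)) = (4 * c) ^ (1 / (1 - α)) * (1 + G) ^ (1 / (1 - α)) := by
          rw [← Real.mul_rpow (by positivity) (by positivity), mul_assoc]
      _ ≤ (4 * c) ^ (1 / (1 - α)) * (2 ^ (1 / (1 - α)) * (1 + P)) := by
          gcongr
          exact YoungEq.one_add_rpow_le hG0 hκ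
      _ = C₂ * (1 + P) := by
          rw [← mul_assoc, ← Real.mul_rpow (by positivity) zero_le_two, hC₂]
          congr 2; ring
      _ = _ := by ring
  set B := 2 * Real.exp C₂ * (1 + ‖x₀‖) * Real.exp (C₂ * P) with hB
  have hxB : ∀ t ∈ Icc (0 : ℝ) 1, ‖x t‖ ≤ B := by
    intro t ht
    have h := hinc.norm_le hα2 hQ hxH ht
    rw [hx.apply_zero] at h
    calc ‖x t‖ ≤ 1 + ‖x t‖ := by linarith
      _ ≤ _ := h
      _ ≤ 2 * Real.exp (C₂ + C₂ * P) * (1 + ‖x₀‖) := by gcongr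
      _ = B := by rw [Real.exp_add, hB]; ring
  refine ⟨hxH, ?_, ?_⟩
  · refine csSup_le ((nonempty_Icc.2 zero_le_one).image _) ?_
    rintro _ ⟨t, ht, rfl⟩
    exact hxB t ht
  · refine (YoungEq.holderNorm_le fun s t hs hst ht =>
      hinc.norm_sub_le hα2 hQ hxH hxB hs hst ht).trans ?_
    set e := Real.exp (C₂ * P) with he
    have he0 : 0 < e := Real.exp_pos _
    have hx0 : 0 ≤ ‖x₀‖ := norm_nonneg _
    have h1 : 1 + B ≤ (1 + 2 * Real.exp C₂) * (1 + ‖x₀‖) * (1 + e) := by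
      have : 0 ≤ e + ‖x₀‖ * (1 + e) + 2 * Real.exp C₂ * (1 + ‖x₀‖) := by positivity
      rw [hB]; linarith
    calc 8 * (c * (1 + G)) * (1 + B)
        ≤ 8 * (c * (1 + G)) * ((1 + 2 * Real.exp C₂) * (1 + ‖x₀‖) * (1 + e)) := by gcongr
      _ = 8 * c * (1 + 2 * Real.exp C₂) * (1 + ‖x₀‖) * 1 * (1 + G) * (1 + e) := by ring
      _ ≤ _ := by
          gcongr
          linarith
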